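/- Let $Z$ be a real random variable with $\mathbb{E}|Z|^K<\infty$, where $K\ge 3$ is an integer. For each $\sigma_N>0$ let $N\sim\mathcal{N}(0,\sigma_N^2)$ be independent of $Z$, let $Y=Z+N$, with mean $\mu$ and variance $\sigma^2=\sigma_N^2+\operatorname{Var}(Z)$, and write the (continuous) density of $Y$ as $\frac1\sigma f\bigl(\frac{y-\mu}{\sigma}\bigr)$; thus $f$, which depends on $\sigma_N$, is the standardized density of $Y$. Let $g(x)=\frac{1}{\sqrt{2\pi}}e^{-x^2/2}$. Let $\varphi_Y(t)=\mathbb{E}(e^{itY})$, let $\kappa_k=(-i)^k(\log\varphi_Y)^{(k)}(0)$ be the cumulants of $Y$, and let the modified moments be $\widetilde m_k=(-i)^k(e^{\psi})^{(k)}(0)$, where $\psi$ is defined near $t=0$ by $\varphi_Y(t)=e^{i\mu t-\sigma^2t^2/2}\,e^{\psi(t)}$. Then: 1. for $3\le k\le K$, $\kappa_k$ and $\widetilde m_k$ do not depend on $\sigma_N$ (they are equal to the same quantities computed for $Z$), and $$\widetilde m_k=\kappa_k+\sum_{j=3}^{k-3}\binom{k-1}{j}\,\widetilde m_j\,\kappa_{k-j};$$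 2. as $\sigma_N\to\infty$, for every $x\in\mathbb{R}$, $$\frac{f(x)}{g(x)}=1+\sum_{k=3}^K\frac{\widetilde m_k}{k!\,\sigma^k}H_k(x)+o\Bigl(\frac1{\sigma^K}\Bigr),$$ where $H_k$ is the $k$-th probabilists' Hermite polynomial ($H_3(x)=x^3-3x$, $H_4(x)=x^4-6x^2+3$, etc.); moreover $$\sup_{x\in\mathbb{R}}\Bigl|f(x)-g(x)\Bigl(1+\sum_{k=3}^K\frac{\widetilde m_k}{k!\,\sigma^k}H_k(x)\Bigr)\Bigr|=o\Bigl(\frac1{\sigma^K}\Bigr).$$ -/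

import Mathlib

open MeasureTheory ProbabilityTheory Filter Asymptotics

noncomputable section

namespace GramCharlier

/-- The `k`-th cumulant of a probability law `P` on the real line: `κ_k = (-i)^k (log φ)^{(k)}(0)`,
where `φ(t) = ∫ e^{itx} dP(x)` is the characteristic function. Since `φ(0) = 1`, the principal
branch of the logarithm is the right one near `0`. The value is real (as `φ(-t)` is the conjugate
of `φ(t)`), and `.re` only views it as a real number. -/
def cumulant (P : Measure ℝ) (k : ℕ) : ℝ :=
  ((-Complex.I) ^ k * iteratedDeriv k (fun t : ℝ => Complex.log (charFun P t)) 0).re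

/-- The Gaussian law with the same mean and the same variance as `P`. -/
def gaussianMatch (P : Measure ℝ) : Measure ℝ :=
  gaussianReal (∫ x, x ∂P) (variance (fun x : ℝ => x) P).toNNReal

/-- The factor `e^{ψ(t)}` in the factorization `φ(t) = φ_*(t) e^{ψ(t)}` of the characteristic
function `φ` of `P`, where `φ_*` is the (nowhere vanishing) characteristic function of the Gaussian
law with the same mean and variance. -/
def nonGaussianFactor (P : Measure ℝ) (t : ℝ) : ℂ :=
  charFun P t / charFun (gaussianMatch P) t

/-- The `k`-th modified moment of `P`: the coefficient in
`e^{ψ(t)} = ∑ m̃_k (it)^k / k!`, that is, `m̃_k = (-i)^k (e^ψ)^{(k)}(0)`.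
It is the `k`-th moment with the first and second cumulants removed, and it is real. -/
def modifiedMoment (P : Measure ℝ) (k : ℕ) : ℝ :=
  ((-Complex.I) ^ k * iteratedDeriv k (nonGaussianFactor P) 0).re

/-- `p` is the continuous density of `P` with respect to Lebesgue measure (a law has at most one
continuous density). -/
structure IsContinuousDensity (P : Measure ℝ) (p : ℝ → ℝ) : Prop where
  continuous : Continuous p
  nonneg : ∀ y, 0 ≤ p y
  eq_withDensity : P = volume.withDensity (fun y => ENNReal.ofReal (p y))

/-- The `K`-th Gram-Charlier partial sum
`1 + ∑_{k=3}^K m̃_k / (k! σ^k) H_k(x)` with the probabilists' Hermite polynomials `H_k`. -/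
def partialSum (m : ℕ → ℝ) (σ : ℝ) (K : ℕ) (x : ℝ) : ℝ :=
  1 + ∑ k ∈ Finset.Icc 3 K,
    m k / ((Nat.factorial k : ℝ) * σ ^ k) * Polynomial.aeval x (Polynomial.hermite k)

end GramCharlier

end

namespace GramCharlier

open Complex ComplexConjugate Topology FourierTransform

/-! Write `Φ = φ / φ_*` for the non-Gaussian factor. Adding the noise multiplies `φ` by
`e^{-s²t²/2}` and the matched Gaussian `φ_*` by the same factor, so `Φ` is literally the same
function for `Y` and for `Z`. Hence the modified moments do not change, and `log φ` changes only by
a quadratic term, which cumulants of order at least 3 do not see. Near `0`, `Φ = e^ψ` with `Φ' = Φ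
ψ'`; Leibniz' rule at `0` gives the recursion, because `ψ` has no terms of order 1 or 2.

For the expansion, Fourier inversion gives `f(x) = (2π)⁻¹ ∫ e^{-itx} e^{-t²/2} Φ(t/σ) dt`, and `g`
times the partial sum is the same integral with `Φ` replaced by its Taylor polynomial `T` of degree
`K` (`abs_standardizedDensity_sub_le`). The error is thus bounded, uniformly in `x`, by `(2π)⁻¹ ∫
e^{-t²/2} |Φ - T|(t/σ) dt`. As `Φ` is a fixed `C^K` function, `Φ - T = o(u^K)` at `0`, and dominated
convergence shows that this integral is `o(σ^{-K})` (`tendsto_pow_mul_integral_norm_sub`). Dividing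
by `g(x) > 0` gives the pointwise statement. -/

/-! ### Derivatives at `0` of Hermitian functions, exponentials and quadratics. -/

/-- Iterated derivatives of a function of a real variable commute with conjugation. -/
lemma iteratedDeriv_conj (F : ℝ → ℂ) (k : ℕ) :
    iteratedDeriv k (fun t => conj (F t)) = fun t => conj (iteratedDeriv k F t) := by
  induction k with
  | zero => simp [iteratedDeriv_zero]
  | succ k ih =>
    rw [iteratedDeriv_succ, ih, iteratedDeriv_succ]
    exact deriv.star'

/-- The derivatives at `0` of a Hermitian function are real up to a power of `i`. -/
lemma iteratedDeriv_zero_of_hermitian {F : ℝ → ℂ} (hF : ∀ᶠ t in 𝓝 0, F (-t) = conj (F t)) (k : ℕ) :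
    iteratedDeriv k F 0 = I ^ k * (((-I) ^ k * iteratedDeriv k F 0).re : ℝ) := by
  have h := Filter.EventuallyEq.iteratedDeriv_eq (f := fun t => F (-t)) k hF
  rw [iteratedDeriv_comp_neg, iteratedDeriv_conj, neg_zero] at h
  set a := iteratedDeriv k F 0
  have hreal : conj ((-I) ^ k * a) = (-I) ^ k * a := by
    have h' : (-1 : ℝ) ^ k • a = conj a := h
    rw [map_mul, ← h', map_pow, map_neg, conj_I, neg_neg, Complex.real_smul, ← mul_assoc]
    push_cast
    rw [← mul_pow, mul_neg_one]
  rw [Complex.conj_eq_iff_re.mp hreal, ← mul_assoc, ← mul_pow]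
  simp

/-- Leibniz recursion for the derivatives of the exponential of a function. -/
lemma iteratedDeriv_succ_of_eventuallyEq_exp {F ψ : ℝ → ℂ} {n : ℕ} {x : ℝ}
    (hψ : ContDiffAt ℝ (n + 1 : ℕ) ψ x) (hF : F =ᶠ[𝓝 x] fun t => exp (ψ t)) :
    iteratedDeriv (n + 1) F x = ∑ j ∈ Finset.range (n + 1),
      (n.choose j : ℂ) * iteratedDeriv j F x * iteratedDeriv (n + 1 - j) ψ x := by
  have hexp : ContDiffAt ℝ (n + 1 : ℕ) (fun t => exp (ψ t)) x := hψ.cexp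
  have hFc : ContDiffAt ℝ n F x :=
    (hexp.congr_of_eventuallyEq hF).of_le (by exact_mod_cast n.le_succ)
  have hdiff : ∀ᶠ t in 𝓝 x, DifferentiableAt ℝ ψ t := by
    have h1 : ContDiffAt ℝ 1 ψ x := hψ.of_le (by exact_mod_cast Nat.succ_le_succ n.zero_le)
    filter_upwards [h1.eventually (by simp)] with t ht
    exact ht.differentiableAt (by simp)
  -- The identity `F' = F ψ'` must hold on a neighbourhood, since it is differentiated `n` more
  -- times.
  have hderiv : deriv F =ᶠ[𝓝 x] F * deriv ψ := by
    filter_upwards [hF.eventuallyEq_nhds, hdiff, hF] with t ht hd h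
    rw [ht.deriv_eq, Pi.mul_apply, h]
    exact (hd.hasDerivAt.cexp).deriv
  have hψ' : ContDiffAt ℝ n (deriv ψ) x := by
    have := hψ.derivWithin (m := n) (by norm_cast)
    simpa using this
  rw [iteratedDeriv_succ', hderiv.iteratedDeriv_eq, iteratedDeriv_mul hFc hψ']
  refine Finset.sum_congr rfl fun j hj => ?_
  rw [Nat.succ_sub (Nat.lt_succ_iff.mp (Finset.mem_range.mp hj)), ← iteratedDeriv_succ']

/-- The derivatives at `0` of a quadratic polynomial without constant term. -/
lemma iteratedDeriv_quadratic_zero (a b : ℂ) :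
    iteratedDeriv 1 (fun t : ℝ => a * t + b * t ^ 2 / 2) 0 = a ∧
    iteratedDeriv 2 (fun t : ℝ => a * t + b * t ^ 2 / 2) 0 = b ∧
    ∀ k, 3 ≤ k → iteratedDeriv k (fun t : ℝ => a * t + b * t ^ 2 / 2) 0 = 0 := by
  have h1 : deriv (fun t : ℝ => a * (t : ℂ) + b * t ^ 2 / 2) = fun t : ℝ => a + b * t := by
    ext t
    have h := (((hasDerivAt_id t).ofReal_comp).const_mul a).add
      (((((hasDerivAt_id t).ofReal_comp).pow 2).const_mul b).div_const 2)
    refine (h.congr_deriv ?_).deriv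
    simp
    ring
  have h2 : deriv (fun t : ℝ => a + b * (t : ℂ)) = fun _ : ℝ => b := by
    ext t
    have h := (((hasDerivAt_id t).ofReal_comp).const_mul b).const_add a
    refine (h.congr_deriv ?_).deriv
    simp
  refine ⟨by simp [iteratedDeriv_one, h1], by simp [iteratedDeriv_succ', h1, h2], fun k hk => ?_⟩
  obtain ⟨n, rfl⟩ := Nat.exists_eq_add_of_le' hk
  rw [iteratedDeriv_succ', iteratedDeriv_succ', iteratedDeriv_succ', h1, h2]
  simp



/-! ### Smoothness and symmetry of the non-Gaussian factor and of `log φ`. -/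

lemma nonGaussianFactor_eq (Q : Measure ℝ) (t : ℝ) :
    nonGaussianFactor Q t = charFun Q t *
      exp (-(∫ x, x ∂Q : ℝ) * I * t + (variance (fun x : ℝ => x) Q : ℝ) * t ^ 2 / 2) := by
  rw [nonGaussianFactor, gaussianMatch, charFun_gaussianReal, div_eq_mul_inv, ← exp_neg]
  rw [Real.coe_toNNReal _ (variance_nonneg _ _)]
  congr 2
  ring

lemma nonGaussianFactor_neg (Q : Measure ℝ) (t : ℝ) :
    nonGaussianFactor Q (-t) = conj (nonGaussianFactor Q t) := by
  simp [nonGaussianFactor, charFun_neg, map_div₀]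

lemma contDiff_nonGaussianFactor {Q : Measure ℝ} [IsProbabilityMeasure Q] {K : ℕ}
    (hQ : MemLp id K Q) : ContDiff ℝ K (nonGaussianFactor Q) := by
  rw [funext (nonGaussianFactor_eq Q)]
  have h1 := contDiff_charFun hQ
  have h2 : ContDiff ℝ K (fun t : ℝ => (t : ℂ)) := ofRealCLM.contDiff
  fun_prop

lemma eventually_charFun_mem_slitPlane (Q : Measure ℝ) [IsProbabilityMeasure Q] :
    ∀ᶠ t in 𝓝 (0 : ℝ), charFun Q t ∈ slitPlane := by
  have h : ContinuousAt (charFun Q) 0 := continuous_charFun.continuousAt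
  exact h.eventually_mem (isOpen_slitPlane.mem_nhds (by simp))

lemma contDiffAt_log_charFun {Q : Measure ℝ} [IsProbabilityMeasure Q] {K : ℕ}
    (hQ : MemLp id K Q) : ContDiffAt ℝ K (fun t : ℝ => log (charFun Q t)) 0 :=
  ((contDiffAt_log (x := charFun Q 0) (by simp)).restrict_scalars ℝ).comp 0
    (contDiff_charFun hQ).contDiffAt

lemma iteratedDeriv_log_charFun_zero (Q : Measure ℝ) [IsProbabilityMeasure Q] (k : ℕ) :
    iteratedDeriv k (fun t : ℝ => log (charFun Q t)) 0 = I ^ k * cumulant Q k := by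
  refine iteratedDeriv_zero_of_hermitian ?_ k
  filter_upwards [eventually_charFun_mem_slitPlane Q] with t ht
  rw [charFun_neg, log_conj _ (mem_slitPlane_iff_arg.mp ht).1]

lemma iteratedDeriv_nonGaussianFactor_zero (Q : Measure ℝ) (k : ℕ) :
    iteratedDeriv k (nonGaussianFactor Q) 0 = I ^ k * modifiedMoment Q k :=
  iteratedDeriv_zero_of_hermitian (.of_forall (nonGaussianFactor_neg Q)) k

/-! ### Cumulants, modified moments and their recursion. -/

section Cumulants

variable {Q : Measure ℝ} [IsProbabilityMeasure Q]

lemma iteratedDeriv_one_log_charFun_zero (hQ : MemLp id 2 Q) :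
    iteratedDeriv 1 (fun t : ℝ => log (charFun Q t)) 0 = I * (∫ x, x ∂Q : ℝ) := by
  have hQ1 : MemLp id (1 : ℕ) Q := by simpa using hQ.mono_exponent one_le_two
  have h := iteratedDeriv_succ_of_eventuallyEq_exp (n := 0) (F := charFun Q)
    (contDiffAt_log_charFun hQ1) (by
      filter_upwards [eventually_charFun_mem_slitPlane Q] with t ht
      rw [exp_log (slitPlane_ne_zero ht)])
  rw [zero_add, iteratedDeriv_charFun_zero hQ1] at h
  simpa using h.symm

lemma iteratedDeriv_two_log_charFun_zero (hQ : MemLp id 2 Q) :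
    iteratedDeriv 2 (fun t : ℝ => log (charFun Q t)) 0
      = -(variance (fun x : ℝ => x) Q : ℝ) := by
  have hQ1 : MemLp id (1 : ℕ) Q := by simpa using hQ.mono_exponent one_le_two
  have hQ2 : MemLp id (2 : ℕ) Q := by simpa using hQ
  have h := iteratedDeriv_succ_of_eventuallyEq_exp (n := 1) (F := charFun Q)
    (contDiffAt_log_charFun hQ2) (by
      filter_upwards [eventually_charFun_mem_slitPlane Q] with t ht
      rw [exp_log (slitPlane_ne_zero ht)])
  have h1 := iteratedDeriv_one_log_charFun_zero hQ
  have hv : variance (fun x : ℝ => x) Q = ∫ x, x ^ 2 ∂Q - (∫ x, x ∂Q) ^ 2 := by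
    simpa using variance_eq_sub (X := fun x : ℝ => x) hQ
  simp only [Nat.reduceAdd] at h
  rw [iteratedDeriv_charFun_zero hQ2] at h
  simp only [Finset.sum_range_succ, Finset.range_zero, Finset.sum_empty, zero_add, Nat.choose_self,
    Nat.choose_zero_right, Nat.sub_zero, iteratedDeriv_zero, charFun_zero, Nat.reduceSub, h1,
    iteratedDeriv_charFun_zero hQ1] at h
  simp only [probReal_univ, ofReal_one, Nat.cast_one, one_mul, pow_one] at h
  have : iteratedDeriv 2 (fun t : ℝ => log (charFun Q t)) 0
      = -1 * ((∫ x, x ^ 2 ∂Q : ℝ) : ℂ) - I * (∫ x, x ∂Q : ℝ) * (I * (∫ x, x ∂Q : ℝ)) := by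
    rw [← I_sq, h]; ring
  rw [this, hv]
  push_cast
  linear_combination (-(((∫ x, x ∂Q : ℝ) : ℂ)) ^ 2) * I_sq

/-- The logarithm of the non-Gaussian factor. -/
noncomputable def logFactor (Q : Measure ℝ) (t : ℝ) : ℂ :=
  log (charFun Q t) +
    (-(∫ x, x ∂Q : ℝ) * I * t + (variance (fun x : ℝ => x) Q : ℝ) * t ^ 2 / 2)

lemma nonGaussianFactor_eventuallyEq :
    nonGaussianFactor Q =ᶠ[𝓝 0] fun t => exp (logFactor Q t) := by
  filter_upwards [eventually_charFun_mem_slitPlane Q] with t ht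
  rw [nonGaussianFactor_eq, logFactor, exp_add (log _), exp_log (slitPlane_ne_zero ht)]

lemma contDiff_quadratic (a b : ℂ) {n : WithTop ℕ∞} :
    ContDiff ℝ n (fun t : ℝ => a * t + b * t ^ 2 / 2) := by
  have h2 : ContDiff ℝ n (fun t : ℝ => (t : ℂ)) := ofRealCLM.contDiff
  fun_prop

lemma contDiffAt_logFactor {K : ℕ} (hQ : MemLp id K Q) : ContDiffAt ℝ K (logFactor Q) 0 :=
  (contDiffAt_log_charFun hQ).add (contDiff_quadratic _ _).contDiffAt

/-- The quadratic in `logFactor` is chosen to cancel the mean and the variance, which are the first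
two cumulants, and it has no effect from order 3 on. -/
lemma iteratedDeriv_logFactor_zero {K : ℕ} (hK : 2 ≤ K) (hQ : MemLp id K Q) {k : ℕ}
    (hk0 : 0 < k) (hk : k ≤ K) :
    iteratedDeriv k (logFactor Q) 0 = if 3 ≤ k then I ^ k * cumulant Q k else 0 := by
  have hQ2 : MemLp id 2 Q := hQ.mono_exponent (by exact_mod_cast hK)
  have hle : ((k : ℕ) : WithTop ℕ∞) ≤ K := by exact_mod_cast hk
  obtain ⟨hq1, hq2, hq3⟩ := iteratedDeriv_quadratic_zero (-(∫ x, x ∂Q : ℝ) * I)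
    (variance (fun x : ℝ => x) Q : ℝ)
  unfold logFactor
  rw [iteratedDeriv_fun_add ((contDiffAt_log_charFun hQ).of_le hle)
    (contDiff_quadratic _ _).contDiffAt]
  split_ifs with h3
  · rw [hq3 k h3, iteratedDeriv_log_charFun_zero, add_zero]
  · obtain rfl | rfl : k = 1 ∨ k = 2 := by omega
    · rw [hq1, iteratedDeriv_one_log_charFun_zero hQ2]; ring
    · rw [hq2, iteratedDeriv_two_log_charFun_zero hQ2]; ring

/-- Leibniz' rule for `Φ' = Φ ψ'` at `0`; the powers `I ^ j` and `I ^ (n + 1 - j)` combine into a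
common factor that cancels. -/
lemma modifiedMoment_succ {K : ℕ} (hK : 2 ≤ K) (hQ : MemLp id K Q) {n : ℕ} (hn : n + 1 ≤ K) :
    modifiedMoment Q (n + 1) = ∑ j ∈ Finset.range (n + 1),
      (n.choose j : ℝ) * modifiedMoment Q j *
        (if 3 ≤ n + 1 - j then cumulant Q (n + 1 - j) else 0) := by
  have h := iteratedDeriv_succ_of_eventuallyEq_exp (n := n)
    ((contDiffAt_logFactor hQ).of_le (by exact_mod_cast hn)) (nonGaussianFactor_eventuallyEq (Q := Q))
  have hI : I ^ (n + 1) ≠ 0 := pow_ne_zero _ I_ne_zero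
  rw [iteratedDeriv_nonGaussianFactor_zero] at h
  have key : (I ^ (n + 1) * modifiedMoment Q (n + 1) : ℂ) = I ^ (n + 1) *
      ((∑ j ∈ Finset.range (n + 1), (n.choose j : ℝ) * modifiedMoment Q j *
        (if 3 ≤ n + 1 - j then cumulant Q (n + 1 - j) else 0) : ℝ) : ℂ) := by
    rw [h]
    push_cast
    rw [Finset.mul_sum]
    refine Finset.sum_congr rfl fun j hj => ?_
    have hj' : j < n + 1 := Finset.mem_range.mp hj
    rw [iteratedDeriv_nonGaussianFactor_zero, iteratedDeriv_logFactor_zero hK hQ (by omega)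
      (by omega)]
    have hpow : (I : ℂ) ^ (n + 1) = I ^ j * I ^ (n + 1 - j) := by
      rw [← pow_add, Nat.add_sub_cancel' hj'.le]
    rw [hpow]
    split_ifs
    · ring
    · simp
  exact_mod_cast mul_left_cancel₀ hI key

lemma modifiedMoment_zero : modifiedMoment Q 0 = 1 := by
  have h := iteratedDeriv_nonGaussianFactor_zero Q 0
  simp only [iteratedDeriv_zero, nonGaussianFactor_eq, charFun_zero] at h
  simp at h
  exact_mod_cast h.symm

lemma modifiedMoment_one {K : ℕ} (hK : 2 ≤ K) (hQ : MemLp id K Q) : modifiedMoment Q 1 = 0 := by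
  simpa using modifiedMoment_succ hK hQ (n := 0) (by omega)

lemma modifiedMoment_two {K : ℕ} (hK : 2 ≤ K) (hQ : MemLp id K Q) : modifiedMoment Q 2 = 0 := by
  simpa [Finset.sum_range_succ] using modifiedMoment_succ hK hQ (n := 1) (by omega)

/-- The recursion expressing the modified moments in terms of the cumulants. -/
lemma modifiedMoment_eq_cumulant_add_sum {K : ℕ} (hQ : MemLp id K Q) {k : ℕ}
    (hk3 : 3 ≤ k) (hk : k ≤ K) :
    modifiedMoment Q k = cumulant Q k + ∑ j ∈ Finset.Icc 3 (k - 3),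
      (Nat.choose (k - 1) j : ℝ) * modifiedMoment Q j * cumulant Q (k - j) := by
  have hK : 2 ≤ K := by omega
  obtain ⟨n, rfl⟩ : ∃ n, k = n + 1 := ⟨k - 1, by omega⟩
  rw [modifiedMoment_succ hK hQ hk, Finset.range_eq_Ico,
    Finset.sum_eq_sum_Ico_succ_bot n.succ_pos]
  congr 1
  · simp [modifiedMoment_zero, hk3]
  · symm
    -- The term `j = 0` was the cumulant itself. Those with `j = 1, 2` vanish with the modified
    -- moment, those with `j > k - 3` with the derivative of `ψ`.
    refine Finset.sum_subset_zero_on_sdiff (fun j hj => ?_) (fun j hj => ?_) (fun j hj => ?_)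
    · simp only [Finset.mem_Icc, Finset.mem_Ico] at hj ⊢
      omega
    · simp only [Finset.mem_Icc, Finset.mem_Ico, Finset.mem_sdiff] at hj
      by_cases h : 3 ≤ n + 1 - j
      · obtain rfl | rfl : j = 1 ∨ j = 2 := by omega
        · simp [modifiedMoment_one hK hQ]
        · simp [modifiedMoment_two hK hQ]
      · simp [h]
    · simp only [Finset.mem_Icc] at hj
      rw [if_pos (by omega), Nat.add_sub_cancel]

end Cumulants

/-! ### Invariance under Gaussian noise. -/

section Noise

variable {Q ν : Measure ℝ}

/-- The non-Gaussian factor is unchanged by the addition of a centered Gaussian noise. -/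
lemma nonGaussianFactor_eq_of_charFun_eq {w : ℝ}
    (hchar : ∀ t : ℝ, charFun ν t = charFun Q t * Real.exp (-(w * t ^ 2 / 2)))
    (hmean : ∫ x, x ∂ν = ∫ x, x ∂Q)
    (hvar : variance (fun x : ℝ => x) ν = w + variance (fun x : ℝ => x) Q) :
    nonGaussianFactor ν = nonGaussianFactor Q := by
  ext t
  rw [nonGaussianFactor_eq, nonGaussianFactor_eq, hchar, hmean, hvar, ofReal_exp, mul_assoc,
    ← exp_add]
  congr 2
  push_cast
  ring

/-- The cumulants of order at least `3` are unchanged by the addition of a centered Gaussian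
noise. -/
lemma cumulant_eq_of_charFun_eq [IsProbabilityMeasure Q] {w : ℝ} {k : ℕ}
    (hQ : MemLp id k Q)
    (hchar : ∀ t : ℝ, charFun ν t = charFun Q t * Real.exp (-(w * t ^ 2 / 2))) (hk : 3 ≤ k) :
    cumulant ν k = cumulant Q k := by
  have h : (fun t : ℝ => log (charFun ν t)) =ᶠ[𝓝 0]
      fun t : ℝ => log (charFun Q t) + (0 * (t : ℂ) + (-w) * (t : ℂ) ^ 2 / 2) := by
    filter_upwards [eventually_charFun_mem_slitPlane Q] with t ht
    rw [hchar, log_mul_ofReal _ (Real.exp_pos _) _ (slitPlane_ne_zero ht), Real.log_exp, add_comm]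
    push_cast
    ring
  rw [cumulant, cumulant, h.iteratedDeriv_eq, iteratedDeriv_fun_add (contDiffAt_log_charFun hQ)
    (contDiff_quadratic _ _).contDiffAt, (iteratedDeriv_quadratic_zero 0 (-w)).2.2 k hk, add_zero]

end Noise

/-! ### Taylor expansion of the non-Gaussian factor, and the `L¹` estimate. -/

/-- The polynomial `1 + ∑_{k=3}^K m_k (iu)^k / k!`. -/
noncomputable def charPartialSum (m : ℕ → ℝ) (K : ℕ) (u : ℝ) : ℂ :=
  1 + ∑ k ∈ Finset.Icc 3 K, (m k / (Nat.factorial k : ℝ) : ℝ) * (I * u) ^ k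

lemma continuous_charPartialSum (m : ℕ → ℝ) (K : ℕ) : Continuous (charPartialSum m K) := by
  unfold charPartialSum
  fun_prop

/-- Away from `0` the top power dominates: with `δ ≤ 1`, both `1` and `|u|` are at most `|u| / δ`.
-/
lemma norm_charPartialSum_le (m : ℕ → ℝ) (K : ℕ) {δ u : ℝ} (hδ : 0 < δ) (hδ1 : δ ≤ 1)
    (hu : δ ≤ |u|) :
    ‖charPartialSum m K u‖ ≤
      (1 + ∑ k ∈ Finset.Icc 3 K, |m k / (Nat.factorial k : ℝ)|) * (|u| / δ) ^ K := by
  have h1 : 1 ≤ |u| / δ := (one_le_div hδ).mpr hu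
  have h2 : |u| ≤ |u| / δ := le_div_self (abs_nonneg u) hδ hδ1
  rw [add_mul, Finset.sum_mul, one_mul, charPartialSum]
  refine (norm_add_le _ _).trans (add_le_add ?_ ((norm_sum_le _ _).trans
    (Finset.sum_le_sum fun k hk => ?_)))
  · simpa using one_le_pow₀ h1
  · rw [norm_mul, norm_pow, norm_mul, norm_real, norm_real, norm_I, one_mul, Real.norm_eq_abs,
      Real.norm_eq_abs]
    gcongr
    exact (pow_le_pow_left₀ (abs_nonneg u) h2 k).trans
      (pow_le_pow_right₀ h1 (Finset.mem_Icc.mp hk).2)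

section

variable {Q : Measure ℝ} [IsProbabilityMeasure Q] {K : ℕ}

lemma taylorWithinEval_nonGaussianFactor (hK : 3 ≤ K) (hQ : MemLp id K Q) (u : ℝ) :
    taylorWithinEval (nonGaussianFactor Q) K Set.univ 0 u
      = charPartialSum (modifiedMoment Q) K u := by
  have hterm : ∀ k : ℕ, (((Nat.factorial k : ℝ))⁻¹ * (u - 0) ^ k) •
      iteratedDerivWithin k (nonGaussianFactor Q) Set.univ 0
      = ((modifiedMoment Q k / (Nat.factorial k : ℝ) : ℝ) : ℂ) * (I * u) ^ k := fun k => by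
    rw [iteratedDerivWithin_univ, iteratedDeriv_nonGaussianFactor_zero, sub_zero,
      Complex.real_smul, mul_pow]
    push_cast
    ring
  rw [taylor_within_apply, Finset.sum_congr rfl fun k _ => hterm k, charPartialSum,
    Finset.range_eq_Ico, Finset.sum_eq_sum_Ico_succ_bot K.succ_pos,
    Finset.sum_eq_sum_Ico_succ_bot (by omega), Finset.sum_eq_sum_Ico_succ_bot (by omega)]
  simp [modifiedMoment_zero, modifiedMoment_one (by omega) hQ, modifiedMoment_two (by omega) hQ]
  rfl

lemma nonGaussianFactor_sub_isLittleO (hK : 3 ≤ K) (hQ : MemLp id K Q) :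
    (fun u => nonGaussianFactor Q u - charPartialSum (modifiedMoment Q) K u)
      =o[𝓝 0] fun u : ℝ => u ^ K := by
  have h := taylor_isLittleO_univ (x₀ := 0) (contDiff_nonGaussianFactor hQ)
  simpa [taylorWithinEval_nonGaussianFactor hK hQ] using h

/-- As `|φ| ≤ 1`, all growth comes from dividing by the matched Gaussian. -/
lemma norm_nonGaussianFactor_le (u : ℝ) :
    ‖nonGaussianFactor Q u‖ ≤ Real.exp (variance (fun x : ℝ => x) Q * u ^ 2 / 2) := by
  rw [nonGaussianFactor_eq, norm_mul, norm_exp]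
  have h : (-(∫ x, x ∂Q : ℝ) * I * u + (variance (fun x : ℝ => x) Q : ℝ) * u ^ 2 / 2 : ℂ).re
      = variance (fun x : ℝ => x) Q * u ^ 2 / 2 := by
    have : (-(∫ x, x ∂Q : ℝ) * I * u + (variance (fun x : ℝ => x) Q : ℝ) * u ^ 2 / 2 : ℂ)
      = ((variance (fun x : ℝ => x) Q * u ^ 2 / 2 : ℝ) : ℂ)
        + ((-(∫ x, x ∂Q) * u : ℝ) : ℂ) * I := by push_cast; ring
    rw [this]
    simp only [add_re, ofReal_re, re_ofReal_mul, I_re, mul_zero, add_zero]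
  rw [h]
  exact mul_le_of_le_one_left (Real.exp_pos _).le (norm_charFun_le_one u)

/-- A global bound for the Taylor remainder of the non-Gaussian factor. -/
lemma exists_norm_nonGaussianFactor_sub_le (hK : 3 ≤ K) (hQ : MemLp id K Q) :
    ∃ C : ℝ, 0 ≤ C ∧ ∀ u : ℝ, ‖nonGaussianFactor Q u - charPartialSum (modifiedMoment Q) K u‖
      ≤ C * |u| ^ K * Real.exp (variance (fun x : ℝ => x) Q * u ^ 2 / 2) := by
  obtain ⟨δ₀, hδ₀, h₀⟩ := Metric.eventually_nhds_iff.mp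
    ((nonGaussianFactor_sub_isLittleO hK hQ).bound one_pos)
  set δ := min δ₀ 1
  have hδ : 0 < δ := lt_min hδ₀ one_pos
  set S := ∑ k ∈ Finset.Icc 3 K, |modifiedMoment Q k / (Nat.factorial k : ℝ)|
  have hS : 0 ≤ S := Finset.sum_nonneg fun _ _ => abs_nonneg _
  -- The `1` serves `|u| < δ`, where the Taylor estimate applies; `(2 + S) / δ ^ K` serves `|u| ≥
  -- δ`, where the two terms are bounded separately.
  refine ⟨1 + (2 + S) / δ ^ K, by positivity, fun u => ?_⟩
  have hE : 1 ≤ Real.exp (variance (fun x : ℝ => x) Q * u ^ 2 / 2) :=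
    Real.one_le_exp (by have := variance_nonneg (fun x : ℝ => x) Q; positivity)
  set E := Real.exp (variance (fun x : ℝ => x) Q * u ^ 2 / 2)
  have hu0 : 0 ≤ |u| ^ K := by positivity
  rcases lt_or_ge |u| δ with hu | hu
  · have h := h₀ (y := u) (by simpa using hu.trans_le (min_le_left _ _))
    rw [one_mul, norm_pow, Real.norm_eq_abs] at h
    refine h.trans ?_
    have h1 : |u| ^ K ≤ (1 + (2 + S) / δ ^ K) * |u| ^ K :=
      le_mul_of_one_le_left hu0 (le_add_of_nonneg_right (by positivity))
    exact h1.trans (le_mul_of_one_le_right (by positivity) hE)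
  · have hT := norm_charPartialSum_le (modifiedMoment Q) K hδ (min_le_right _ _) hu
    have hΦ := norm_nonGaussianFactor_le (Q := Q) u
    have h1 : 1 ≤ (|u| / δ) ^ K := one_le_pow₀ ((one_le_div hδ).mpr hu)
    calc ‖nonGaussianFactor Q u - charPartialSum (modifiedMoment Q) K u‖
        ≤ E + (1 + S) * (|u| / δ) ^ K := (norm_sub_le _ _).trans (add_le_add hΦ hT)
      _ ≤ (|u| / δ) ^ K * E + (1 + S) * (|u| / δ) ^ K * E :=
          add_le_add (le_mul_of_one_le_left (by positivity) h1)
            (le_mul_of_one_le_right (by positivity) hE)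
      _ = (2 + S) / δ ^ K * |u| ^ K * E := by rw [div_pow]; ring
      _ ≤ (1 + (2 + S) / δ ^ K) * |u| ^ K * E := by
          gcongr
          linarith

/-- The `L¹` norm of the difference of the Fourier transforms is `o(σ^{-K})`. -/
lemma tendsto_pow_mul_integral_norm_sub (hK : 3 ≤ K) (hQ : MemLp id K Q) :
    Tendsto (fun σ : ℝ => σ ^ K * ∫ t : ℝ, Real.exp (-(t ^ 2 / 2)) *
      ‖nonGaussianFactor Q (t / σ) - charPartialSum (modifiedMoment Q) K (t / σ)‖)
      atTop (𝓝 0) := by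
  obtain ⟨C, hC, hbound⟩ := exists_norm_nonGaussianFactor_sub_le hK hQ
  have hcont : Continuous fun u =>
      ‖nonGaussianFactor Q u - charPartialSum (modifiedMoment Q) K u‖ :=
    ((contDiff_nonGaussianFactor hQ).continuous.sub (continuous_charPartialSum _ _)).norm
  set v := variance (fun x : ℝ => x) Q with hv
  have hv0 : 0 ≤ v := variance_nonneg _ _
  simp_rw [← integral_const_mul]
  rw [← integral_zero ℝ ℝ]
  refine tendsto_integral_filter_of_dominated_convergence
    (fun t => C * (|t| ^ K * Real.exp (-(t ^ 2 / 4)))) ?_ ?_ ?_ ?_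
  · exact .of_forall fun σ => Continuous.aestronglyMeasurable
      (continuous_const.mul ((by fun_prop : Continuous fun t : ℝ => Real.exp (-(t ^ 2 / 2))).mul
        (hcont.comp (continuous_id.div_const σ))))
  -- Once `σ² ≥ 2v`, the growth `e^{v t²/(2σ²)}` uses up at most half of the Gaussian exponent,
  -- leaving `e^{-t²/4}`.
  · filter_upwards [eventually_gt_atTop 0, eventually_ge_atTop (2 * v + 1)] with σ hσ hσv
    have hσ2 : 2 * v ≤ σ ^ 2 := by nlinarith
    refine .of_forall fun t => ?_
    rw [Real.norm_of_nonneg (by positivity)]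
    have hexp : Real.exp (-(t ^ 2 / 2)) * Real.exp (v * (t / σ) ^ 2 / 2)
        ≤ Real.exp (-(t ^ 2 / 4)) := by
      rw [← Real.exp_add, Real.exp_le_exp, div_pow]
      have : v * (t ^ 2 / σ ^ 2) ≤ t ^ 2 / 2 := by
        rw [← mul_div_assoc, div_le_div_iff₀ (by positivity) two_pos]
        nlinarith [sq_nonneg t]
      linarith
    calc σ ^ K * (Real.exp (-(t ^ 2 / 2)) * _)
        ≤ σ ^ K * (Real.exp (-(t ^ 2 / 2)) *
          (C * |t / σ| ^ K * Real.exp (v * (t / σ) ^ 2 / 2))) := by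
          gcongr
          exact hbound _
      _ = C * |t| ^ K * (Real.exp (-(t ^ 2 / 2)) * Real.exp (v * (t / σ) ^ 2 / 2)) := by
          rw [abs_div, abs_of_pos hσ, div_pow]
          field_simp
      _ ≤ C * |t| ^ K * Real.exp (-(t ^ 2 / 4)) := by gcongr
      _ = C * (|t| ^ K * Real.exp (-(t ^ 2 / 4))) := by ring
  · refine Integrable.const_mul ?_ C
    have h := (integrable_rpow_mul_exp_neg_mul_sq (b := 1 / 4) (by norm_num)
      (s := K) (by have : (0 : ℝ) ≤ K := K.cast_nonneg; linarith)).norm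
    refine h.congr (.of_forall fun t => ?_)
    simp only [norm_mul, Real.rpow_natCast, norm_pow, Real.norm_eq_abs, Real.abs_exp]
    ring_nf
  -- For fixed `t`, `σ^K · o((t/σ)^K) = o(t^K)`, which tends to `0`.
  · refine .of_forall fun t => ?_
    have hdiv : Tendsto (fun σ : ℝ => t / σ) atTop (𝓝 0) := tendsto_const_nhds.div_atTop tendsto_id
    have h := ((nonGaussianFactor_sub_isLittleO hK hQ).comp_tendsto hdiv).norm_left
    have h2 : (fun σ : ℝ => Real.exp (-(t ^ 2 / 2)) * ‖nonGaussianFactor Q (t / σ) -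
        charPartialSum (modifiedMoment Q) K (t / σ)‖) =o[atTop] fun σ : ℝ => (t / σ) ^ K :=
      h.const_mul_left _
    have h3 := (isBigO_refl (fun σ : ℝ => σ ^ K) atTop).mul_isLittleO h2
    have h4 : (fun σ : ℝ => σ ^ K * (t / σ) ^ K) =ᶠ[atTop] fun _ => t ^ K := by
      filter_upwards [eventually_gt_atTop 0] with σ hσ
      rw [← mul_pow, mul_div_cancel₀ _ hσ.ne']
    exact (isLittleO_one_iff ℝ).mp
      ((h3.trans_eventuallyEq h4).trans_isBigO (isBigO_const_const _ one_ne_zero _))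

end

/-! ### Fourier inversion and Hermite functions. -/

/-- Fourier inversion for the continuous density of a law with integrable characteristic
function. -/
lemma IsContinuousDensity.eq_integral_charFun {Q : Measure ℝ} [IsProbabilityMeasure Q]
    {p : ℝ → ℝ} (hp : IsContinuousDensity Q p) (hint : Integrable (charFun Q)) (y : ℝ) :
    (p y : ℂ) = (2 * Real.pi : ℝ)⁻¹ * ∫ t : ℝ, exp (-(t * y * I)) * charFun Q t := by
  have hpi : Integrable p := by
    refine ⟨hp.continuous.aestronglyMeasurable, ?_⟩
    rw [hasFiniteIntegral_iff_ofReal (.of_forall hp.nonneg)]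
    have h : Q Set.univ = 1 := measure_univ
    rw [hp.eq_withDensity, withDensity_apply _ .univ, Measure.restrict_univ] at h
    simp [h]
  -- The transform `𝓕` has kernel `e^{-2πixw}`, hence the rescaling by `-2π`, undone by `hsub`.
  have hF : 𝓕 (fun x : ℝ => (p x : ℂ)) = fun w : ℝ => charFun Q (-2 * Real.pi * w) := by
    ext w
    rw [Real.fourier_real_eq_integral_exp_smul, charFun_apply_real]
    conv_rhs => rw [hp.eq_withDensity]
    rw [integral_withDensity_eq_integral_toReal_smul
      hp.continuous.measurable.ennreal_ofReal (.of_forall fun _ => ENNReal.ofReal_lt_top)]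
    refine integral_congr_ae (.of_forall fun x => ?_)
    simp only [ENNReal.toReal_ofReal (hp.nonneg x), Complex.real_smul, smul_eq_mul]
    rw [mul_comm]
    congr 2
    push_cast
    ring
  have ha : (-2 * Real.pi) ≠ 0 := by simp [Real.pi_ne_zero]
  have hinv := congrFun (Continuous.fourierInv_fourier_eq
    (f := fun x : ℝ => (p x : ℂ)) (continuous_ofReal.comp hp.continuous) hpi.ofReal
    (by rw [hF]; exact hint.comp_mul_left' ha)) y
  rw [hF, Real.fourierInv_eq'] at hinv
  rw [← hinv]
  have hsub := Measure.integral_comp_mul_left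
    (fun t : ℝ => exp (-(t * y * I)) * charFun Q t) (-2 * Real.pi)
  have habs : |(-2 * Real.pi)⁻¹| = (2 * Real.pi)⁻¹ := by
    rw [neg_mul, inv_neg, abs_neg, abs_of_pos (by positivity)]
  rw [habs, Complex.real_smul] at hsub
  rw [← hsub]
  refine integral_congr_ae (.of_forall fun t => ?_)
  simp only [smul_eq_mul]
  congr 2
  simp
  ring

/-- The characteristic function is `e^{-t²/2}`, so this is Rodrigues' formula. -/
lemma iteratedDeriv_charFun_gaussianReal (n : ℕ) :
    iteratedDeriv n (charFun (gaussianReal 0 1)) = fun t : ℝ =>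
      (((-1 : ℝ) ^ n * Polynomial.aeval t (Polynomial.hermite n) *
        Real.exp (-(t ^ 2 / 2)) : ℝ) : ℂ) := by
  induction n with
  | zero =>
    ext t
    simp [charFun_gaussianReal]
  | succ n ih =>
    ext t
    rw [iteratedDeriv_succ, ih, ← Polynomial.deriv_gaussian_eq_hermite_mul_gaussian,
      Function.iterate_succ_apply',
      funext (Polynomial.deriv_gaussian_eq_hermite_mul_gaussian n)]
    refine (HasDerivAt.ofReal_comp (DifferentiableAt.hasDerivAt ?_)).deriv
    have := (Polynomial.hermite n).differentiable_aeval (𝕜 := ℝ)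
    fun_prop

/-- The Fourier representation of the Hermite functions. -/
lemma gaussianPDFReal_mul_hermite (n : ℕ) (x : ℝ) :
    ((gaussianPDFReal 0 1 x * Polynomial.aeval x (Polynomial.hermite n) : ℝ) : ℂ) =
      (2 * Real.pi : ℝ)⁻¹ *
        ∫ t : ℝ, exp (-(t * x * I)) * ((I * t) ^ n * (Real.exp (-(t ^ 2 / 2)) : ℝ)) := by
  have hm : MemLp id n (gaussianReal 0 1) := memLp_id_gaussianReal n
  have h1 := iteratedDeriv_charFun (t := -x) hm
  -- Moments against `e^{-itx}` are derivatives at `-x`; evenness brings them back to `x` with a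
  -- sign `(-1)^n`, which cancels the one in Rodrigues' formula.
  have heven : (fun t : ℝ => charFun (gaussianReal 0 1) (-t)) = charFun (gaussianReal 0 1) := by
    ext t
    simp [charFun_gaussianReal, -charFun_neg]
  have h2 := iteratedDeriv_comp_neg n (charFun (gaussianReal 0 1)) x
  rw [heven, h1, iteratedDeriv_charFun_gaussianReal,
    integral_gaussianReal_eq_integral_smul one_ne_zero] at h2
  have hpdf (t : ℝ) : gaussianPDFReal 0 1 t = (√(2 * Real.pi))⁻¹ * Real.exp (-(t ^ 2 / 2)) := by
    simp [gaussianPDFReal, neg_div]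
  have hI : ∫ t : ℝ, exp (-(t * x * I)) * ((I * t) ^ n * (Real.exp (-(t ^ 2 / 2)) : ℝ))
      = √(2 * Real.pi) * (I ^ n * ∫ t : ℝ, gaussianPDFReal 0 1 t •
        ((t : ℂ) ^ n * exp ((-x : ℝ) * t * I))) := by
    rw [← integral_const_mul, ← integral_const_mul]
    refine integral_congr_ae (.of_forall fun t => ?_)
    have hs : (√(2 * Real.pi) : ℂ) ≠ 0 := by
      exact_mod_cast (Real.sqrt_pos.mpr Real.two_pi_pos).ne'
    have he : exp ((-x : ℝ) * t * I) = exp (-(t * x * I)) := by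
      congr 1
      push_cast
      ring
    simp only [hpdf, Complex.real_smul, he, mul_pow, ofReal_mul, ofReal_inv]
    field_simp
  have h3 : I ^ n * ∫ t : ℝ, gaussianPDFReal 0 1 t • ((t : ℂ) ^ n * exp ((-x : ℝ) * t * I))
      = ((Polynomial.aeval x (Polynomial.hermite n) * Real.exp (-(x ^ 2 / 2)) : ℝ) : ℂ) := by
    have h4 : ((-1 : ℝ) ^ n) * (-1) ^ n = 1 := by rw [← mul_pow]; simp
    have h5 (z : ℂ) : (-1 : ℝ) ^ n • ((-1 : ℝ) ^ n • z) = z := by rw [smul_smul, h4, one_smul]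
    rw [← h5 (I ^ n * _), ← h2, Complex.real_smul, ← ofReal_mul, ← mul_assoc, ← mul_assoc, h4,
      one_mul]
  rw [hI, h3, hpdf, ← ofReal_mul, ← ofReal_mul]
  congr 1
  have hs : √(2 * Real.pi) * √(2 * Real.pi) = 2 * Real.pi := Real.mul_self_sqrt Real.two_pi_pos.le
  have hs0 : √(2 * Real.pi) ≠ 0 := (Real.sqrt_pos.mpr Real.two_pi_pos).ne'
  generalize √(2 * Real.pi) = c at hs hs0 ⊢
  rw [← hs]
  field_simp

lemma integrable_fourier_hermite (n : ℕ) (x : ℝ) :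
    Integrable fun t : ℝ => exp (-(t * x * I)) * ((I * t) ^ n * (Real.exp (-(t ^ 2 / 2)) : ℝ)) := by
  have h := integrable_rpow_mul_exp_neg_mul_sq (b := 1 / 2) (by norm_num)
      (s := n) (by have : (0 : ℝ) ≤ n := n.cast_nonneg; linarith)
  refine h.mono (Continuous.aestronglyMeasurable (by fun_prop)) (.of_forall fun t => ?_)
  have h1 : exp (-(t * x * I)) = exp ((-(t * x) : ℝ) * I) := by push_cast; ring_nf
  rw [norm_mul, h1, norm_exp_ofReal_mul_I, one_mul, norm_mul, norm_pow, norm_mul, norm_I, one_mul,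
    norm_real, norm_real, norm_mul, Real.rpow_natCast, norm_pow]
  ring_nf
  exact le_rfl

lemma fourier_charPartialSum_eq_sum (m : ℕ → ℝ) (σ : ℝ) (K : ℕ) (x t : ℝ) :
    exp (-(t * x * I)) * ((Real.exp (-(t ^ 2 / 2)) : ℝ) * charPartialSum m K (t / σ)) =
      exp (-(t * x * I)) * ((I * t) ^ 0 * (Real.exp (-(t ^ 2 / 2)) : ℝ)) +
      ∑ k ∈ Finset.Icc 3 K, (m k / ((Nat.factorial k : ℝ) * σ ^ k) : ℝ) *
        (exp (-(t * x * I)) * ((I * t) ^ k * (Real.exp (-(t ^ 2 / 2)) : ℝ))) := by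
  rw [charPartialSum, mul_add, mul_add, Finset.mul_sum, Finset.mul_sum, pow_zero, one_mul, mul_one]
  congr 1
  refine Finset.sum_congr rfl fun k _ => ?_
  push_cast
  rw [← mul_div_assoc, div_pow]
  ring

lemma integrable_fourier_charPartialSum (m : ℕ → ℝ) (σ : ℝ) (K : ℕ) (x : ℝ) :
    Integrable fun t : ℝ =>
      exp (-(t * x * I)) * ((Real.exp (-(t ^ 2 / 2)) : ℝ) * charPartialSum m K (t / σ)) := by
  simp_rw [fourier_charPartialSum_eq_sum]
  exact (integrable_fourier_hermite 0 x).add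
    (integrable_finsetSum _ fun k _ => (integrable_fourier_hermite k x).const_mul _)

/-- The Fourier representation of the Gram-Charlier partial sums. -/
lemma gaussianPDFReal_mul_partialSum (m : ℕ → ℝ) (σ : ℝ) (K : ℕ) (x : ℝ) :
    ((gaussianPDFReal 0 1 x * partialSum m σ K x : ℝ) : ℂ) = (2 * Real.pi : ℝ)⁻¹ *
      ∫ t : ℝ, exp (-(t * x * I)) *
        ((Real.exp (-(t ^ 2 / 2)) : ℝ) * charPartialSum m K (t / σ)) := by
  simp_rw [fourier_charPartialSum_eq_sum]
  rw [integral_add (integrable_fourier_hermite 0 x)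
    (integrable_finsetSum _ fun k _ => (integrable_fourier_hermite k x).const_mul _),
    integral_finsetSum _ fun k _ => (integrable_fourier_hermite k x).const_mul _,
    mul_add, ← gaussianPDFReal_mul_hermite, Finset.mul_sum, partialSum, mul_add, Finset.mul_sum,
    ofReal_add, ofReal_sum]
  congr 1
  · simp
  · refine Finset.sum_congr rfl fun k _ => ?_
    rw [integral_const_mul, mul_left_comm (((2 * Real.pi)⁻¹ : ℝ) : ℂ),
      ← gaussianPDFReal_mul_hermite, ← ofReal_mul, mul_left_comm]

/-! ### Fourier representation of the standardized density. -/

section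

variable {Q : Measure ℝ} {f : ℝ → ℝ} {σ : ℝ}

/-- At `y = μ + σx` and frequency `t/σ`, the mean cancels and the matched Gaussian becomes
`e^{-t²/2}`. -/
lemma exp_mul_charFun_div (hσ : 0 < σ) (hvar : σ ^ 2 = variance (fun x : ℝ => x) Q) (x t : ℝ) :
    exp (-((t / σ : ℝ) * ((∫ x, x ∂Q) + σ * x : ℝ) * I)) * charFun Q (t / σ) =
      exp (-(t * x * I)) * ((Real.exp (-(t ^ 2 / 2)) : ℝ) * nonGaussianFactor Q (t / σ)) := by
  have hσ' : (σ : ℂ) ≠ 0 := by exact_mod_cast hσ.ne'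
  rw [nonGaussianFactor_eq, ← hvar, mul_left_comm _ (charFun Q _), mul_left_comm _ (charFun Q _),
    ofReal_exp, ← exp_add, ← exp_add, mul_comm]
  congr 2
  push_cast
  field_simp
  ring

variable [IsProbabilityMeasure Q]

/-- The Fourier representation of a standardized density. -/
lemma standardizedDensity_eq_integral (hσ : 0 < σ)
    (hvar : σ ^ 2 = variance (fun x : ℝ => x) Q)
    (hf : IsContinuousDensity Q (fun y => 1 / σ * f ((y - ∫ x, x ∂Q) / σ)))
    (hint : Integrable (charFun Q)) (x : ℝ) :
    Integrable (fun t : ℝ => exp (-(t * x * I)) *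
      ((Real.exp (-(t ^ 2 / 2)) : ℝ) * nonGaussianFactor Q (t / σ))) ∧
    (f x : ℂ) = (2 * Real.pi : ℝ)⁻¹ * ∫ t : ℝ, exp (-(t * x * I)) *
      ((Real.exp (-(t ^ 2 / 2)) : ℝ) * nonGaussianFactor Q (t / σ)) := by
  have hσ' : (σ : ℂ) ≠ 0 := by exact_mod_cast hσ.ne'
  set h : ℝ → ℂ := fun t => exp (-(t * ((∫ x, x ∂Q) + σ * x : ℝ) * I)) * charFun Q t with hh
  have hcomp : (fun t : ℝ => h (t / σ)) = fun t : ℝ => exp (-(t * x * I)) *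
      ((Real.exp (-(t ^ 2 / 2)) : ℝ) * nonGaussianFactor Q (t / σ)) :=
    funext fun t => exp_mul_charFun_div hσ hvar x t
  have hhint : Integrable h := by
    refine hint.mono (Continuous.aestronglyMeasurable
      (.mul (by fun_prop) continuous_charFun)) (.of_forall fun t => ?_)
    have h1 : exp (-(t * ((∫ x, x ∂Q) + σ * x : ℝ) * I))
        = exp ((-(t * ((∫ x, x ∂Q) + σ * x)) : ℝ) * I) := by push_cast; ring_nf
    rw [hh]
    simp only
    rw [norm_mul, h1, norm_exp_ofReal_mul_I, one_mul]
  have hinv := hf.eq_integral_charFun hint ((∫ x, x ∂Q) + σ * x)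
  have hsub := Measure.integral_comp_div h σ
  rw [hcomp, abs_of_pos hσ, Complex.real_smul] at hsub
  refine ⟨hcomp ▸ hhint.comp_div hσ.ne', ?_⟩
  rw [hsub, mul_left_comm, ← hinv, add_sub_cancel_left, mul_div_cancel_left₀ _ hσ.ne']
  push_cast
  field_simp

/-- The error of the Gram-Charlier expansion is bounded, uniformly on the line, by the `L¹` norm of
its Fourier transform. -/
lemma abs_standardizedDensity_sub_le (hσ : 0 < σ)
    (hvar : σ ^ 2 = variance (fun x : ℝ => x) Q)
    (hf : IsContinuousDensity Q (fun y => 1 / σ * f ((y - ∫ x, x ∂Q) / σ)))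
    (hint : Integrable (charFun Q)) (m : ℕ → ℝ) (K : ℕ) (x : ℝ) :
    |f x - gaussianPDFReal 0 1 x * partialSum m σ K x| ≤
      (2 * Real.pi)⁻¹ * ∫ t : ℝ, Real.exp (-(t ^ 2 / 2)) *
        ‖nonGaussianFactor Q (t / σ) - charPartialSum m K (t / σ)‖ := by
  obtain ⟨hi, he⟩ := standardizedDensity_eq_integral hσ hvar hf hint x
  rw [← Real.norm_eq_abs, ← norm_real, ofReal_sub, he, gaussianPDFReal_mul_partialSum, ← mul_sub,
    ← integral_sub hi (integrable_fourier_charPartialSum m σ K x), norm_mul, norm_real,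
    Real.norm_of_nonneg (by positivity)]
  gcongr
  refine (norm_integral_le_integral_norm _).trans_eq
    (integral_congr_ae (.of_forall fun t => ?_))
  have h1 : exp (-(t * x * I)) = exp ((-(t * x) : ℝ) * I) := by push_cast; ring_nf
  simp only
  rw [← mul_sub, ← mul_sub, norm_mul, h1, norm_exp_ofReal_mul_I, one_mul, norm_mul, norm_real,
    Real.norm_of_nonneg (Real.exp_pos _).le]

end

/-- The noise supplies the Gaussian decay that Fourier inversion needs. -/
lemma integrable_charFun_of_eq {Q ν : Measure ℝ} [IsProbabilityMeasure Q]
    [IsProbabilityMeasure ν] {w : ℝ} (hw : 0 < w)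
    (hchar : ∀ t : ℝ, charFun ν t = charFun Q t * Real.exp (-(w * t ^ 2 / 2))) :
    Integrable (charFun ν) := by
  refine (integrable_exp_neg_mul_sq (b := w / 2) (by positivity)).mono
    continuous_charFun.aestronglyMeasurable (.of_forall fun t => ?_)
  rw [hchar, norm_mul, norm_real]
  refine (mul_le_of_le_one_left (norm_nonneg _) (norm_charFun_le_one t)).trans_eq ?_
  congr 2
  ring

end GramCharlier

/-! ### The main theorem. -/

theorem lemma1
    {Ω : Type*} [MeasurableSpace Ω] (P : Measure Ω) [IsProbabilityMeasure P]
    (K : ℕ) (hK : 3 ≤ K)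
    -- the signal, with a finite moment of order `K`
    (Z : Ω → ℝ) (hZ : MemLp Z (K : ENNReal) P)
    -- for each standard deviation `s > 0`, a Gaussian noise `N s` independent of `Z`
    (N : ℝ → Ω → ℝ)
    (hN : ∀ s : ℝ, 0 < s → HasLaw (N s) (gaussianReal 0 (s ^ 2).toNNReal) P)
    (hZN : ∀ s : ℝ, 0 < s → IndepFun Z (N s) P)
    -- the observation `Y = Z + N`, with its mean and its standard deviation
    (Y : ℝ → Ω → ℝ) (hY : ∀ s, Y s = fun ω => Z ω + N s ω)
    (μ σ : ℝ → ℝ) (hμ : ∀ s, μ s = ∫ ω, Y s ω ∂P) (hσ : ∀ s, σ s = √(variance (Y s) P))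
    -- the density of `Y` is `y ↦ (1/σ) f((y - μ)/σ)`, and `g` is the standard normal density
    (f : ℝ → ℝ → ℝ)
    (hf : ∀ s : ℝ, 0 < s → GramCharlier.IsContinuousDensity (P.map (Y s))
      (fun y => 1 / σ s * f s ((y - μ s) / σ s)))
    (g : ℝ → ℝ) (hg : g = gaussianPDFReal 0 1) :
    -- the cumulants and the modified moments of `Y` do not depend on the noise level
    (∀ s : ℝ, 0 < s → ∀ k ∈ Finset.Icc 3 K,
      GramCharlier.cumulant (P.map (Y s)) k = GramCharlier.cumulant (P.map Z) k ∧
      GramCharlier.modifiedMoment (P.map (Y s)) k = GramCharlier.modifiedMoment (P.map Z) k) ∧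
    -- the recursion
    (∀ s : ℝ, 0 < s → ∀ k ∈ Finset.Icc 3 K,
      GramCharlier.modifiedMoment (P.map (Y s)) k =
        GramCharlier.cumulant (P.map (Y s)) k +
          ∑ j ∈ Finset.Icc 3 (k - 3), (Nat.choose (k - 1) j : ℝ) *
            GramCharlier.modifiedMoment (P.map (Y s)) j *
            GramCharlier.cumulant (P.map (Y s)) (k - j)) ∧
    -- the expansion, at each point `x`
    (∀ x : ℝ,
      (fun s => f s x / g x -
        GramCharlier.partialSum (GramCharlier.modifiedMoment (P.map (Y s))) (σ s) K x)
      =o[atTop] (fun s => 1 / σ s ^ K)) ∧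
    -- the remainder in the expansion of the density is uniform on the real line
    (∀ ε : ℝ, 0 < ε → ∀ᶠ s in atTop, ∀ x : ℝ,
      |f s x - g x *
        GramCharlier.partialSum (GramCharlier.modifiedMoment (P.map (Y s))) (σ s) K x|
      ≤ ε * (1 / σ s ^ K)) := by
  have hK2 : (2 : ENNReal) ≤ K := by exact_mod_cast (by omega : 2 ≤ K)
  have hZ2 : MemLp Z 2 P := hZ.mono_exponent hK2
  have hZm : AEMeasurable Z P := hZ.aemeasurable
  have : IsProbabilityMeasure (P.map Z) := Measure.isProbabilityMeasure_map hZm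
  have hQ : MemLp id K (P.map Z) := (memLp_map_measure_iff (by fun_prop) hZm).mpr hZ
  have hYm (s : ℝ) (hs : 0 < s) : AEMeasurable (Y s) P := by
    rw [hY]
    exact hZm.add (hN s hs).aemeasurable
  have hYp (s : ℝ) (hs : 0 < s) : IsProbabilityMeasure (P.map (Y s)) :=
    Measure.isProbabilityMeasure_map (hYm s hs)
  have hcoe (s : ℝ) : (((s ^ 2).toNNReal : NNReal) : ℝ) = s ^ 2 :=
    Real.coe_toNNReal _ (sq_nonneg s)
  have hNLp (s : ℝ) (hs : 0 < s) (p : NNReal) : MemLp (N s) p P := by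
    have h := memLp_id_gaussianReal (μ := 0) (v := (s ^ 2).toNNReal) p
    rw [← (hN s hs).map_eq] at h
    exact (memLp_map_measure_iff (by fun_prop) (hN s hs).aemeasurable).mp h
  have hYLp (s : ℝ) (hs : 0 < s) : MemLp id K (P.map (Y s)) := by
    refine (memLp_map_measure_iff (by fun_prop) (hYm s hs)).mpr ?_
    rw [hY]
    exact hZ.add (by simpa using hNLp s hs K)
  have hchar (s : ℝ) (hs : 0 < s) (t : ℝ) :
      charFun (P.map (Y s)) t = charFun (P.map Z) t * Real.exp (-(s ^ 2 * t ^ 2 / 2)) := by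
    rw [hY, (hZN s hs).charFun_map_fun_add_eq_mul hZm (hN s hs).aemeasurable, Pi.mul_apply,
      (hN s hs).map_eq, charFun_gaussianReal, hcoe]
    push_cast
    simp
  have hNmean (s : ℝ) (hs : 0 < s) : ∫ ω, N s ω ∂P = 0 := by
    rw [(hN s hs).integral_eq, integral_id_gaussianReal]
  have hmeanmap (X : Ω → ℝ) (hX : AEMeasurable X P) : ∫ x, x ∂(P.map X) = ∫ ω, X ω ∂P :=
    integral_map hX (by fun_prop)
  have hvarmap (X : Ω → ℝ) (hX : AEMeasurable X P) :
      variance (fun x : ℝ => x) (P.map X) = variance X P :=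
    variance_map (X := fun x : ℝ => x) (by fun_prop) hX
  have hmean (s : ℝ) (hs : 0 < s) : ∫ x, x ∂(P.map (Y s)) = ∫ x, x ∂(P.map Z) := by
    rw [hmeanmap _ (hYm s hs), hmeanmap _ hZm, hY]
    simp only
    rw [integral_add (hZ2.integrable one_le_two) (by simpa using (hNLp s hs 1).integrable (by simp)),
      hNmean s hs, add_zero]
  have hvar (s : ℝ) (hs : 0 < s) : variance (fun x : ℝ => x) (P.map (Y s))
      = s ^ 2 + variance (fun x : ℝ => x) (P.map Z) := by
    rw [hvarmap _ (hYm s hs), hvarmap _ hZm, hY,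
      (hZN s hs).variance_fun_add hZ2 (by simpa using hNLp s hs 2), (hN s hs).variance_eq,
      variance_id_gaussianReal, hcoe, add_comm]
  have hv0 : 0 ≤ variance (fun x : ℝ => x) (P.map Z) := variance_nonneg _ _
  have hσsq (s : ℝ) (hs : 0 < s) : σ s ^ 2 = variance (fun x : ℝ => x) (P.map (Y s)) := by
    rw [hσ, Real.sq_sqrt (variance_nonneg _ _), hvarmap _ (hYm s hs)]
  have hσpos (s : ℝ) (hs : 0 < s) : 0 < σ s := by
    rw [hσ, ← hvarmap _ (hYm s hs), hvar s hs]
    positivity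
  have hσtop : Tendsto σ atTop atTop := by
    refine tendsto_atTop_mono' _ ?_ tendsto_id
    filter_upwards [eventually_gt_atTop 0] with s hs
    refine (pow_le_pow_iff_left₀ hs.le (hσpos s hs).le two_ne_zero).mp ?_
    rw [hσsq s hs, hvar s hs]
    exact le_add_of_nonneg_right hv0
  have hfactor (s : ℝ) (hs : 0 < s) :
      GramCharlier.nonGaussianFactor (P.map (Y s)) = GramCharlier.nonGaussianFactor (P.map Z) :=
    GramCharlier.nonGaussianFactor_eq_of_charFun_eq (hchar s hs) (hmean s hs) (hvar s hs)
  have hmoment (s : ℝ) (hs : 0 < s) :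
      GramCharlier.modifiedMoment (P.map (Y s)) = GramCharlier.modifiedMoment (P.map Z) := by
    ext k
    simp only [GramCharlier.modifiedMoment, hfactor s hs]
  have hunif : ∀ ε : ℝ, 0 < ε → ∀ᶠ s in atTop, ∀ x : ℝ,
      |f s x - g x *
        GramCharlier.partialSum (GramCharlier.modifiedMoment (P.map (Y s))) (σ s) K x|
      ≤ ε * (1 / σ s ^ K) := by
    intro ε hε
    have h := (GramCharlier.tendsto_pow_mul_integral_norm_sub hK hQ).comp hσtop
    have h2π : 0 < 2 * Real.pi := Real.two_pi_pos
    -- The threshold `2πε` absorbs the factor `(2π)⁻¹` of Fourier inversion.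
    filter_upwards [eventually_gt_atTop 0, h.eventually_lt_const (mul_pos h2π hε)]
      with s hs hlt x
    have := hYp s hs
    have hμs : μ s = ∫ x, x ∂(P.map (Y s)) := by rw [hμ, hmeanmap _ (hYm s hs)]
    have hfs := hf s hs
    rw [hμs] at hfs
    have hb := GramCharlier.abs_standardizedDensity_sub_le (hσpos s hs) (hσsq s hs) hfs
      (GramCharlier.integrable_charFun_of_eq (pow_pos hs 2) (hchar s hs))
      (GramCharlier.modifiedMoment (P.map (Y s))) K x
    rw [← hg] at hb
    refine hb.trans ?_
    rw [hfactor s hs, hmoment s hs]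
    have hσK : 0 < σ s ^ K := pow_pos (hσpos s hs) K
    rw [mul_one_div, le_div_iff₀ hσK, mul_assoc, inv_mul_le_iff₀ h2π, mul_comm (integral _ _)]
    exact hlt.le
  refine ⟨fun s hs k hk => ?_, fun s hs k hk => ?_, fun x => ?_, hunif⟩
  · rw [Finset.mem_Icc] at hk
    exact ⟨GramCharlier.cumulant_eq_of_charFun_eq
      (hQ.mono_exponent (by exact_mod_cast hk.2)) (hchar s hs) hk.1, by rw [hmoment s hs]⟩
  · rw [Finset.mem_Icc] at hk
    have := hYp s hs
    exact GramCharlier.modifiedMoment_eq_cumulant_add_sum (hYLp s hs) hk.1 hk.2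
  · have hgx : 0 < g x := by
      rw [hg]
      exact gaussianPDFReal_pos 0 1 x one_ne_zero
    refine isLittleO_iff.mpr fun ε hε => ?_
    -- The tolerance `ε * g x` pays for dividing by `g x`; it depends on `x`, so uniformity is lost
    -- here.
    filter_upwards [hunif (ε * g x) (mul_pos hε hgx), eventually_gt_atTop 0] with s hs hs0
    have hσK : 0 < 1 / σ s ^ K := one_div_pos.mpr (pow_pos (hσpos s hs0) K)
    rw [Real.norm_of_nonneg hσK.le, Real.norm_eq_abs]
    have h := hs x
    have heq : f s x / g x -
        GramCharlier.partialSum (GramCharlier.modifiedMoment (P.map (Y s))) (σ s) K x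
        = (f s x - g x * GramCharlier.partialSum
          (GramCharlier.modifiedMoment (P.map (Y s))) (σ s) K x) / g x := by
      field_simp
    rw [heq, abs_div, abs_of_pos hgx, div_le_iff₀ hgx]
    exact h.trans_eq (by ring)
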